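/- Let $f\colon\mathbb R^n\to\mathbb R$ be locally Lipschitz continuous, let $F\colon\mathbb R^n\rightrightarrows\mathbb R^m$ and $G\colon\mathbb R^n\times\mathbb R^m\rightrightarrows\mathbb R^s$ be set-valued mappings with closed graphs, and let $M\subset\mathbb R^n$ be nonempty and closed. Consider the problem $$\min_z\ f(z)\quad\text{s.t.}\quad 0\in H(z):=\bigcup_{\lambda\in F(z)}G(z,\lambda),\qquad z\in M. \tag{P}$$ Set, for $z\in\mathbb R^n$, $w\in\mathbb R^s$, $\lambda\in\mathbb R^m$, $$K(z):=\{\lambda\in F(z)\mid 0\in G(z,\lambda)\},\qquad \widehat K(z,w):=\{\lambda\in F(z)\mid w\in G(z,\lambda)\},$$ $$\mathcal H(z,\lambda):=(F(z)-\lambda)\times G(z,\lambda),\qquad \widehat{\mathcal H}(z,w,\lambda):=(F(z)-\lambda)\times(G(z,\lambda)-w).$$ For $A\subset\mathbb R^d$ and $a\in A$, let $\mathcal T_A(a)$ be the Bouligand tangent cone, $\widehat{\mathcal N}_A(a):=\{\xi\mid \xi^\top d\le 0\ \forall d\in\mathcal T_A(a)\}$ the regular normal cone, and $\mathcal N_A(a)$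 the limiting normal cone, i.e. the set of all limits $\xi=\lim_k\xi_k$ with $\xi_k\in\widehat{\mathcal N}_A(a_k)$, $a_k\in A$, $a_k\to a$. For a set-valued mapping $\Upsilon$, let $\operatorname{gph}\Upsilon:=\{(x,y)\mid y\in\Upsilon(x)\}$, $\operatorname{dom}\Upsilon:=\{x\mid\Upsilon(x)\ne\varnothing\}$, $\Upsilon^{-1}(y):=\{x\mid y\in\Upsilon(x)\}$, and, for $(x,y)\in\operatorname{gph}\Upsilon$, let $D^*\Upsilon(x,y)(\eta):=\{\xi\mid(\xi,-\eta)\in\mathcal N_{\operatorname{gph}\Upsilon}(x,y)\}$ be its limiting coderivative. Let $\partial f(z):=\{\xi\mid(\xi,-1)\in\mathcal N_{\operatorname{epi}f}(z,f(z))\}$ be the limiting subdifferential. $\Upsilon$ is *inner semicompact* at $\bar x$ w.r.t. $\Omega$ if for every sequence $(x_k)\subset\Omega$ with $x_k\to\bar x$ there are a subsequence $(x_{k_l})$ and a convergent sequence $(y_l)$ with $y_l\in\Upsilon(x_{k_l})$ for all $l$. $\Upsilon$ is *metrically subregular* at $(\bar x,\bar y)\in\operatorname{gph}\Upsilon$ if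 there are $\kappa>0$ and a neighborhood $U$ of $\bar x$ such that $\operatorname{dist}(x,\Upsilon^{-1}(\bar y))\le\kappa\operatorname{dist}(\bar y,\Upsilon(x))$ for all $x\in U$, where $\operatorname{dist}(\cdot,\varnothing)=\infty$. A feasible point $\bar z$ of (P) is called - *implicitly M-stationary* if there is $\nu\in\mathbb R^s$ with $0\in\partial f(\bar z)+D^*H(\bar z,0)(\nu)+\mathcal N_M(\bar z)$; - *fuzzily M-stationary* if there are $\bar\lambda\in K(\bar z)$, $\mu\in\mathbb R^m$, $\nu\in\mathbb R^s$ with $(0,0)\in\partial f(\bar z)\times\{0\}+D^*\mathcal H((\bar z,\bar\lambda),(0,0))(\mu,\nu)+\mathcal N_M(\bar z)\times\{0\}$; - *explicitly M-stationary* if there are $\bar\lambda\in K(\bar z)$, $\mu\in\mathbb R^m$, $\nu\in\mathbb R^s$ with $0\in\partial f(\bar z)+D^*F(\bar z,\bar\lambda)(\mu)+\{\xi\mid(\xi,\mu)\in D^*G((\bar z,\bar\lambda),0)(\nu)\}+\mathcal N_M(\bar z)$. For $\lambda\in K(\bar z)$, condition $\mathrm{Inc}(\lambda)$ says that for all $\mu\in\mathbb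 R^m$, $\nu\in\mathbb R^s$, $$D^*\mathcal H((\bar z,\lambda),(0,0))(\mu,\nu)\subset D^*F(\bar z,\lambda)(\mu)\times\{-\mu\}+D^*G((\bar z,\lambda),0)(\nu).$$ **Proposition.** Let $\bar z$ be an implicitly M-stationary point of (P). Assume that $\widehat K$ is inner semicompact at $(\bar z,0)$ w.r.t. $\operatorname{dom}\widehat K$, and that $\widehat{\mathcal H}$ is metrically subregular at $((\bar z,0,\lambda),(0,0))$ for every $\lambda\in K(\bar z)$. Then $\bar z$ is fuzzily M-stationary. If, in addition, $\mathrm{Inc}(\lambda)$ holds for every $\lambda\in K(\bar z)$, then $\bar z$ is explicitly M-stationary. -/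

import Mathlib

open Set Filter Topology
open scoped Pointwise

namespace ImplicitVar

/-- The Euclidean space `ℝⁿ`. -/
abbrev Rn (n : ℕ) := EuclideanSpace ℝ (Fin n)

/-- The product of two Euclidean spaces, with the inner product
`⟪(x, y), (x', y')⟫ = ⟪x, x'⟫ + ⟪y, y'⟫`. Its norm is equivalent to the sum norm `‖x‖ + ‖y‖`,
so limits, neighbourhoods and metric subregularity are the same for both norms. -/
abbrev EProd (E F : Type*) := WithLp 2 (E × F)

/-- The element `(x, y)` of a product of Euclidean spaces. -/
abbrev pair {E F : Type*} (x : E) (y : F) : EProd E F := WithLp.toLp 2 (x, y)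

/-- The product set `A × B`. -/
def prodSet {E F : Type*} (A : Set E) (B : Set F) : Set (EProd E F) :=
  {p | p.fst ∈ A ∧ p.snd ∈ B}

section SetValued

/-- The graph of a set-valued mapping. -/
def gph {E F : Type*} (Υ : E → Set F) : Set (EProd E F) := {p | p.snd ∈ Υ p.fst}

/-- The domain of a set-valued mapping. -/
def dom {E F : Type*} (Υ : E → Set F) : Set E := {z | (Υ z).Nonempty}

/-- The inverse of a set-valued mapping. -/
def inv {E F : Type*} (Υ : E → Set F) : F → Set E := fun w => {z | w ∈ Υ z}

/-- Inner semicompactness of `Υ` at `z` with respect to `Ω`: each sequence in `Ω` converging to `z`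
has a subsequence `z (φ l)` for which there is a convergent sequence `w l ∈ Υ (z (φ l))`. -/
def InnerSemicompactAt {E F : Type*} [TopologicalSpace E] [TopologicalSpace F]
    (Υ : E → Set F) (z : E) (Ω : Set E) : Prop :=
  ∀ u : ℕ → E, (∀ k, u k ∈ Ω) → Tendsto u atTop (𝓝 z) →
    ∃ (φ : ℕ → ℕ) (w : ℕ → F) (wbar : F), StrictMono φ ∧ Tendsto w atTop (𝓝 wbar) ∧
      ∀ l, w l ∈ Υ (u (φ l))

/-- Metric subregularity of `Υ` at a point `(z, w)` of its graph. Distances take values in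
`[0, ∞]`, the distance to the empty set being `∞`. -/
def MetricallySubregularAt {E F : Type*} [PseudoEMetricSpace E] [PseudoEMetricSpace F]
    (Υ : E → Set F) (z : E) (w : F) : Prop :=
  ∃ κ : NNReal, 0 < κ ∧ ∃ U ∈ 𝓝 z, ∀ x ∈ U,
    Metric.infEDist x (inv Υ w) ≤ (κ : ENNReal) * Metric.infEDist w (Υ x)

end SetValued

section Normals

variable {E : Type*} [NormedAddCommGroup E] [InnerProductSpace ℝ E]
variable {F : Type*} [NormedAddCommGroup F] [InnerProductSpace ℝ F]

/-- The Bouligand tangent cone to `A` at `z`. -/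
def tangentCone (A : Set E) (z : E) : Set E :=
  {d | ∃ (u : ℕ → E) (t : ℕ → ℝ), (∀ k, u k ∈ A) ∧ (∀ k, 0 < t k) ∧
    Tendsto u atTop (𝓝 z) ∧ Tendsto t atTop (𝓝 0) ∧
    Tendsto (fun k => (t k)⁻¹ • (u k - z)) atTop (𝓝 d)}

/-- The regular (Fréchet) normal cone: the polar of the tangent cone. -/
def regularNormalCone (A : Set E) (z : E) : Set E :=
  {ξ | ∀ d ∈ tangentCone A z, inner ℝ ξ d ≤ 0}

/-- The limiting (Mordukhovich) normal cone to `A` at `z`. -/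
def limitingNormalCone (A : Set E) (z : E) : Set E :=
  {ξ | ∃ (u η : ℕ → E), (∀ k, u k ∈ A) ∧ Tendsto u atTop (𝓝 z) ∧ Tendsto η atTop (𝓝 ξ) ∧
    ∀ k, η k ∈ regularNormalCone A (u k)}

/-- The epigraph of a real-valued function. -/
def epi (f : E → ℝ) : Set (EProd E ℝ) := {p | f p.fst ≤ p.snd}

/-- The limiting subdifferential of `f` at `z`. -/
def limitingSubdifferential (f : E → ℝ) (z : E) : Set E :=
  {ξ | pair ξ (-1) ∈ limitingNormalCone (epi f) (pair z (f z))}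

/-- The limiting coderivative `D*Υ(z, w)`, a set-valued mapping. -/
def coderivative (Υ : E → Set F) (z : E) (w : F) : F → Set E :=
  fun η => {ξ | pair ξ (-η) ∈ limitingNormalCone (gph Υ) (pair z w)}

end Normals

section Problem

variable {n m s : ℕ}

/-- `H(z) = ⋃_{l ∈ F(z)} G(z, l)`. -/
def mapH (F : Rn n → Set (Rn m)) (G : EProd (Rn n) (Rn m) → Set (Rn s)) : Rn n → Set (Rn s) :=
  fun z => ⋃ l ∈ F z, G (pair z l)

/-- The feasible set of the problem of minimizing `f(z)` subject to `0 ∈ H(z)`, `z ∈ M`. -/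
def feasibleSet (F : Rn n → Set (Rn m)) (G : EProd (Rn n) (Rn m) → Set (Rn s))
    (M : Set (Rn n)) : Set (Rn n) :=
  {z | 0 ∈ mapH F G z ∧ z ∈ M}

/-- `K(z) = {l ∈ F(z) | 0 ∈ G(z, l)}`. -/
def mapK (F : Rn n → Set (Rn m)) (G : EProd (Rn n) (Rn m) → Set (Rn s)) : Rn n → Set (Rn m) :=
  fun z => {l | l ∈ F z ∧ 0 ∈ G (pair z l)}

/-- The intermediate mapping `K̂(z, w) = {l ∈ F(z) | w ∈ G(z, l)}`. -/
def mapKhat (F : Rn n → Set (Rn m)) (G : EProd (Rn n) (Rn m) → Set (Rn s)) :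
    EProd (Rn n) (Rn s) → Set (Rn m) :=
  fun p => {l | l ∈ F p.fst ∧ p.snd ∈ G (pair p.fst l)}

/-- `𝓗(z, l) = (F(z) - l) × G(z, l)`. -/
def mapCalH (F : Rn n → Set (Rn m)) (G : EProd (Rn n) (Rn m) → Set (Rn s)) :
    EProd (Rn n) (Rn m) → Set (EProd (Rn m) (Rn s)) :=
  fun p => prodSet (F p.fst - {p.snd}) (G p)

/-- The feasibility mapping `𝓗̂(z, w, l) = (F(z) - l) × (G(z, l) - w)`. -/
def mapCalHhat (F : Rn n → Set (Rn m)) (G : EProd (Rn n) (Rn m) → Set (Rn s)) :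
    EProd (Rn n) (EProd (Rn s) (Rn m)) → Set (EProd (Rn m) (Rn s)) :=
  fun p => prodSet (F p.fst - {p.snd.snd}) (G (pair p.fst p.snd.snd) - {p.snd.fst})

/-- Implicit M-stationarity of a feasible point `z`. -/
def ImplicitlyMStationary (f : Rn n → ℝ) (F : Rn n → Set (Rn m))
    (G : EProd (Rn n) (Rn m) → Set (Rn s)) (M : Set (Rn n)) (z : Rn n) : Prop :=
  z ∈ feasibleSet F G M ∧ ∃ ν : Rn s,
    0 ∈ limitingSubdifferential f z + coderivative (mapH F G) z 0 ν + limitingNormalCone M z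

/-- Fuzzy M-stationarity of a feasible point `z`. -/
def FuzzilyMStationary (f : Rn n → ℝ) (F : Rn n → Set (Rn m))
    (G : EProd (Rn n) (Rn m) → Set (Rn s)) (M : Set (Rn n)) (z : Rn n) : Prop :=
  z ∈ feasibleSet F G M ∧ ∃ l ∈ mapK F G z, ∃ (μ : Rn m) (ν : Rn s),
    pair 0 0 ∈ prodSet (limitingSubdifferential f z) {(0 : Rn m)}
      + coderivative (mapCalH F G) (pair z l) (pair 0 0) (pair μ ν)
      + prodSet (limitingNormalCone M z) {(0 : Rn m)}

/-- Explicit M-stationarity of a feasible point `z`. -/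
def ExplicitlyMStationary (f : Rn n → ℝ) (F : Rn n → Set (Rn m))
    (G : EProd (Rn n) (Rn m) → Set (Rn s)) (M : Set (Rn n)) (z : Rn n) : Prop :=
  z ∈ feasibleSet F G M ∧ ∃ l ∈ mapK F G z, ∃ (μ : Rn m) (ν : Rn s),
    0 ∈ limitingSubdifferential f z + coderivative F z l μ
      + {ξ | pair ξ μ ∈ coderivative G (pair z l) 0 ν} + limitingNormalCone M z

/-- The inclusion `Inc(l)` at `z`, estimating the coderivative of `𝓗` by those of `F` and `G`. -/
def Inc (F : Rn n → Set (Rn m)) (G : EProd (Rn n) (Rn m) → Set (Rn s))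
    (z : Rn n) (l : Rn m) : Prop :=
  ∀ (μ : Rn m) (ν : Rn s),
    coderivative (mapCalH F G) (pair z l) (pair 0 0) (pair μ ν) ⊆
      prodSet (coderivative F z l μ) {-μ} + coderivative G (pair z l) 0 ν

end Problem

end ImplicitVar

open ImplicitVar

/-! Only the coderivative of `H` needs work: a normal to `gph H` must become a normal to the graph
of `𝓗`. Take regular normals to `gph H` converging to the given one. Since `gph H` is the domain of
`K̂`, inner semicompactness supplies convergent intermediate variables. Each regular normal lifts,
with zero in the new component, to the zero set of `𝓗̂`; in the limit this gives a limiting normal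
to that set. `MetricallySubregularAt.exists_mem_coderivative` puts this normal in the range of the
coderivative of `𝓗̂`: by exact penalization it is approximated by regular normals to the graph, with
multipliers bounded through the subregularity constant. Finally, `gph 𝓗̂` depends on `w` only
through a translation, so `coderivative_mapCalHhat` eliminates `w` and identifies the second
multiplier with `ν`. -/

namespace ImplicitVar

/-! ### Tangent cones and regular normals -/

section NormalCones

variable {E : Type*} [NormedAddCommGroup E] [InnerProductSpace ℝ E]
variable {F : Type*} [NormedAddCommGroup F] [InnerProductSpace ℝ F]

/-- The shift `c` cancels in difference quotients, so `L` carries those of `A` to those of `B`. -/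
theorem map_mem_tangentCone {A : Set E} {B : Set F} (L : E →ₗ[ℝ] F) (hL : Continuous L) (c : F)
    (h : ∀ x ∈ A, L x + c ∈ B) {a d : E} (hd : d ∈ tangentCone A a) :
    L d ∈ tangentCone B (L a + c) := by
  obtain ⟨u, t, hu, ht, hua, ht0, hd⟩ := hd
  refine ⟨fun k => L (u k) + c, t, fun k => h _ (hu k), ht, ?_, ht0, ?_⟩
  · exact ((hL.tendsto a).comp hua).add_const c
  · refine ((hL.tendsto d).comp hd).congr fun k => ?_
    simp

/-- Regular normals pull back along affine maps. -/
theorem regularNormalCone_of_map {A : Set E} {B : Set F} (L : E →ₗ[ℝ] F) (hL : Continuous L) (c : F)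
    (h : ∀ x ∈ A, L x + c ∈ B) {a ξ : E} {b ζ : F} (hb : L a + c = b)
    (hζ : ζ ∈ regularNormalCone B b)
    (hξ : ∀ d, inner ℝ ξ d = inner ℝ ζ (L d)) : ξ ∈ regularNormalCone A a := fun d hd => by
  rw [hξ]
  exact hζ _ (hb ▸ map_mem_tangentCone L hL c h hd)

theorem mem_tangentCone_of_line {A : Set E} {a d : E} (h : ∀ t : ℝ, a + t • d ∈ A) :
    d ∈ tangentCone A a := by
  have ht : Tendsto (fun k : ℕ => 1 / ((k : ℝ) + 1)) atTop (𝓝 0) :=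
    tendsto_one_div_add_atTop_nhds_zero_nat
  refine ⟨fun k => a + (1 / ((k : ℝ) + 1)) • d, fun k => 1 / ((k : ℝ) + 1), fun k => h _,
    fun k => by positivity, ?_, ht, ?_⟩
  · simpa using (ht.smul_const d).const_add a
  · refine tendsto_const_nhds.congr fun k => ?_
    have : ((k : ℝ) + 1) ≠ 0 := by positivity
    simp [smul_smul, this]

/-- In finite dimensions, regular normals satisfy the Fréchet inequality. -/
theorem exists_ball_inner_le [FiniteDimensional ℝ E] {A : Set E} {a ξ : E}
    (hξ : ξ ∈ regularNormalCone A a) {ε : ℝ} (hε : 0 < ε) :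
    ∃ r > 0, ∀ x ∈ A, ‖x - a‖ < r → inner ℝ ξ (x - a) ≤ ε * ‖x - a‖ := by
  by_contra! hcon
  choose u huA hur hu using fun k : ℕ => hcon (1 / ((k : ℝ) + 1)) (by positivity)
  have hpos : ∀ k, 0 < ‖u k - a‖ := fun k => by
    rw [norm_pos_iff]
    intro h0
    have := hu k
    simp [h0] at this
  have ht0 : Tendsto (fun k => ‖u k - a‖) atTop (𝓝 0) :=
    squeeze_zero (fun _ => norm_nonneg _) (fun k => (hur k).le)
      tendsto_one_div_add_atTop_nhds_zero_nat
  -- Normalized violations accumulate at a tangent direction on which `ξ` is at least `ε`.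
  have hsph : ∀ k, ‖u k - a‖⁻¹ • (u k - a) ∈ Metric.sphere (0 : E) 1 := fun k => by
    simp [norm_smul, (hpos k).ne']
  obtain ⟨d, -, φ, hφ, hd⟩ := (isCompact_sphere (0 : E) 1).tendsto_subseq hsph
  have hT : d ∈ tangentCone A a :=
    ⟨u ∘ φ, fun k => ‖u (φ k) - a‖, fun k => huA _, fun k => hpos _,
      (tendsto_iff_norm_sub_tendsto_zero.2 ht0).comp hφ.tendsto_atTop,
      ht0.comp hφ.tendsto_atTop, hd⟩
  have hlim : Tendsto (fun k => inner ℝ ξ (‖u (φ k) - a‖⁻¹ • (u (φ k) - a))) atTop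
      (𝓝 (inner ℝ ξ d)) := tendsto_const_nhds.inner hd
  have : ε ≤ inner ℝ ξ d := by
    refine ge_of_tendsto' hlim fun k => ?_
    rw [inner_smul_right, inv_mul_eq_div, le_div_iff₀ (hpos _)]
    exact (hu _).le
  linarith [hξ d hT]

/-- Fermat's rule for a smooth function on a set. -/
theorem IsLocalMinOn.mem_regularNormalCone {A : Set E} {p ξ : E} {φ : E → ℝ} {φ' : E →L[ℝ] ℝ}
    (hmin : IsLocalMinOn φ A p) (hφ : HasFDerivAt φ φ' p) (hξ : ∀ d, inner ℝ ξ d = -φ' d) :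
    ξ ∈ regularNormalCone A p := by
  rintro d ⟨u, t, hu, ht, hup, -, hd⟩
  rw [hξ, neg_nonpos]
  have hlim := (hφ.hasFDerivWithinAt (s := univ)).lim (c := fun k => (t k)⁻¹)
    (d := fun k => u k - p) (by simpa using hup.sub_const p) (by simp) hd
  refine ge_of_tendsto hlim ?_
  have hup' : Tendsto u atTop (𝓝[A] p) :=
    tendsto_nhdsWithin_iff.2 ⟨hup, Eventually.of_forall hu⟩
  filter_upwards [hup'.eventually hmin] with k hk
  have := inv_pos.2 (ht k)
  simp only [add_sub_cancel, smul_eq_mul]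
  exact mul_nonneg this.le (sub_nonneg.2 hk)

end NormalCones

/-! ### A differentiable substitute for the norm -/

section Smoothing

variable {E : Type*} [NormedAddCommGroup E]

/-- A smooth approximation of the norm from above. -/
noncomputable def smoothNorm (δ : ℝ) (x : E) : ℝ := √(‖x‖ ^ 2 + δ ^ 2)

theorem smoothNorm_pos {δ : ℝ} (hδ : 0 < δ) (x : E) : 0 < smoothNorm δ x :=
  Real.sqrt_pos.2 (by positivity)

theorem norm_le_smoothNorm (δ : ℝ) (x : E) : ‖x‖ ≤ smoothNorm δ x :=
  Real.le_sqrt_of_sq_le (by nlinarith [sq_nonneg δ])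

theorem smoothNorm_zero {δ : ℝ} (hδ : 0 < δ) : smoothNorm δ (0 : E) = δ := by
  simp [smoothNorm, Real.sqrt_sq hδ.le]

theorem hasFDerivAt_smoothNorm [InnerProductSpace ℝ E] {δ : ℝ} (hδ : 0 < δ) (x : E) :
    HasFDerivAt (smoothNorm δ) (innerSL ℝ ((smoothNorm δ x)⁻¹ • x)) x := by
  have h := ((hasStrictFDerivAt_norm_sq x).hasFDerivAt.add_const (δ ^ 2)).sqrt
    (by positivity : ‖x‖ ^ 2 + δ ^ 2 ≠ 0)
  have hp := (smoothNorm_pos hδ x).ne'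
  convert! h using 1
  ext d
  simp only [smoothNorm] at hp
  simp [smoothNorm]
  field_simp

/-- The vector is the gradient of `smoothNorm δ`; this bound turns penalty coefficients into bounds
on normals. -/
theorem norm_inv_smoothNorm_smul_le [NormedSpace ℝ E] {δ : ℝ} (hδ : 0 < δ) (x : E) :
    ‖(smoothNorm δ x)⁻¹ • x‖ ≤ 1 := by
  have hp := smoothNorm_pos hδ x
  rw [norm_smul, norm_inv, Real.norm_of_nonneg hp.le, inv_mul_eq_div, div_le_one hp]
  exact norm_le_smoothNorm δ x

end Smoothing

/-! ### Normals to preimages under metric subregularity -/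

section Subregularity

variable {E : Type*} [NormedAddCommGroup E] [InnerProductSpace ℝ E] [FiniteDimensional ℝ E]
variable {F : Type*} [NormedAddCommGroup F]

/-- Exact penalization of a regular normal to a preimage under a subregularity estimate. -/
theorem exists_ball_inner_le_penalty {Φ : E → Set F} {x₀ ξ : E} {w : F} {κ : NNReal} {U : Set E}
    (hU : U ∈ 𝓝 x₀)
    (hsub : ∀ x ∈ U, Metric.infEDist x (inv Φ w) ≤ (κ : ENNReal) * Metric.infEDist w (Φ x))
    (hξ : ξ ∈ regularNormalCone (inv Φ w) x₀) {ε : ℝ} (hε : 0 < ε) :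
    ∃ r > 0, ∀ x y, y ∈ Φ x → ‖x - x₀‖ ≤ r → ‖y - w‖ ≤ r →
      inner ℝ ξ (x - x₀) ≤ ε * ‖x - x₀‖ + (‖ξ‖ + ε) * κ * ‖y - w‖ := by
  obtain ⟨r₁, hr₁, h₁⟩ := exists_ball_inner_le hξ hε
  obtain ⟨r₂, hr₂, h₂⟩ := Metric.mem_nhds_iff.1 hU
  have hκ : (0 : ℝ) ≤ κ := κ.2
  -- The first bound keeps `x` in `U`; the second keeps an almost nearest point of the preimage
  -- within `r₁` of `x₀`.
  set r : ℝ := min (r₂ / 2) (r₁ / (2 * (1 + κ))) with hr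
  have hrpos : 0 < r := lt_min (by positivity) (by positivity)
  refine ⟨r, hrpos, fun x y hy hx hyw => ?_⟩
  have hxU : x ∈ U := h₂ (by
    rw [Metric.mem_ball, dist_eq_norm]
    linarith [min_le_left (r₂ / 2) (r₁ / (2 * (1 + κ)))])
  have hr1 : (1 + κ) * r ≤ r₁ / 2 := by
    have := min_le_right (r₂ / 2) (r₁ / (2 * (1 + κ)))
    rw [← hr, le_div_iff₀ (by positivity)] at this
    linarith
  have hdist : Metric.infEDist x (inv Φ w) ≤ ENNReal.ofReal (κ * ‖y - w‖) := by
    refine (hsub x hxU).trans ?_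
    rw [ENNReal.ofReal_mul hκ, ENNReal.ofReal_coe_nnreal]
    gcongr
    refine (Metric.infEDist_le_edist_of_mem hy).trans ?_
    rw [edist_dist, dist_comm, dist_eq_norm]
  -- The distance need not be attained, so a slack `τ` is allowed and then sent to zero.
  have key : ∀ τ : ℝ, 0 < τ → τ < r₁ / 2 →
      inner ℝ ξ (x - x₀) ≤ ε * ‖x - x₀‖ + (‖ξ‖ + ε) * (κ * ‖y - w‖ + τ) := by
    intro τ hτ hτ'
    have hlt : Metric.infEDist x (inv Φ w) < ENNReal.ofReal (κ * ‖y - w‖ + τ) :=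
      hdist.trans_lt ((ENNReal.ofReal_lt_ofReal_iff (by positivity)).2 (by linarith))
    obtain ⟨c, hc, hxc⟩ := Metric.infEDist_lt_iff.1 hlt
    rw [edist_dist, ENNReal.ofReal_lt_ofReal_iff (by positivity), dist_eq_norm] at hxc
    have htri : ‖c - x₀‖ ≤ ‖x - x₀‖ + ‖x - c‖ := by
      have := norm_sub_le (x - x₀) (x - c)
      rwa [sub_sub_sub_cancel_left] at this
    have hκy : κ * ‖y - w‖ ≤ κ * r := by gcongr
    have hcn := h₁ c hc (by nlinarith)
    have hcs : inner ℝ ξ (x - c) ≤ ‖ξ‖ * ‖x - c‖ := real_inner_le_norm _ _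
    have hsplit : inner ℝ ξ (x - x₀) = inner ℝ ξ (c - x₀) + inner ℝ ξ (x - c) := by
      rw [← inner_add_right]; congr 1; abel
    have e1 : ε * ‖c - x₀‖ ≤ ε * (‖x - x₀‖ + ‖x - c‖) := by gcongr
    have e2 : (‖ξ‖ + ε) * ‖x - c‖ ≤ (‖ξ‖ + ε) * (κ * ‖y - w‖ + τ) := by gcongr
    linarith
  have hlim : Tendsto (fun τ : ℝ => ε * ‖x - x₀‖ + (‖ξ‖ + ε) * (κ * ‖y - w‖ + τ)) (𝓝[>] 0)
      (𝓝 (ε * ‖x - x₀‖ + (‖ξ‖ + ε) * (κ * ‖y - w‖ + 0))) :=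
    (Continuous.tendsto (by fun_prop) _).mono_left nhdsWithin_le_nhds
  rw [add_zero, ← mul_assoc] at hlim
  refine ge_of_tendsto hlim ?_
  filter_upwards [Ioo_mem_nhdsGT (show (0 : ℝ) < r₁ / 2 by positivity)] with τ hτ
  exact key τ hτ.1 hτ.2

/-- Regular normals to a preimage are approximated by regular normals to the graph, with a bounded
second component, under a subregularity estimate. -/
theorem exists_regularNormalCone_gph_near [InnerProductSpace ℝ F] [FiniteDimensional ℝ F]
    {Φ : E → Set F}
    (hΦ : IsClosed (gph Φ)) {x₀ ξ : E} {w : F} {κ : NNReal} {U : Set E} (hU : U ∈ 𝓝 x₀)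
    (hsub : ∀ x ∈ U, Metric.infEDist x (inv Φ w) ≤ (κ : ENNReal) * Metric.infEDist w (Φ x))
    (hx₀ : x₀ ∈ inv Φ w) (hξ : ξ ∈ regularNormalCone (inv Φ w) x₀) {ε : ℝ} (hε : 0 < ε) :
    ∃ p ∈ gph Φ, ‖p - pair x₀ w‖ ≤ ε ∧ ∃ (ξ' : E) (η : F), ‖ξ' - ξ‖ ≤ 2 * ε ∧
      ‖η‖ ≤ (‖ξ‖ + ε) * κ + ε ∧ pair ξ' η ∈ regularNormalCone (gph Φ) p := by
  obtain ⟨r, hr, hpen⟩ := exists_ball_inner_le_penalty hU hsub hξ hε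
  -- Both penalty coefficients, `b` and `2 * ε`, exceed those of `hpen` by `ε`; the excess makes `φ`
  -- grow at least like `ε` times the distance to the base point.
  set b : ℝ := (‖ξ‖ + ε) * κ + ε with hb
  have hbpos : 0 < b := by have := κ.2; positivity
  -- `φ` equals `(2 * ε + b) * δ` at the base point, so a small `δ` forces the minimizer inside the
  -- ball and within `ε`.
  obtain ⟨δ, hδ, hδr⟩ : ∃ δ > 0, (2 * ε + b) * δ < ε * min r ε :=
    ⟨ε * min r ε / (2 * (2 * ε + b)), by positivity, by
      have : 0 < ε * min r ε := by positivity
      field_simp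
      linarith⟩
  set φ : EProd E F → ℝ := fun p => -inner ℝ ξ (p.fst - x₀) + 2 * ε * smoothNorm δ (p.fst - x₀)
    + b * smoothNorm δ (p.snd - w) with hφ
  have hder : ∀ p : EProd E F, HasFDerivAt φ
      (-(innerSL ℝ ξ).comp (WithLp.fstL 2 ℝ E F)
        + (2 * ε) • (innerSL ℝ ((smoothNorm δ (p.fst - x₀))⁻¹ • (p.fst - x₀))).comp
          (WithLp.fstL 2 ℝ E F)
        + b • (innerSL ℝ ((smoothNorm δ (p.snd - w))⁻¹ • (p.snd - w))).comp
          (WithLp.sndL 2 ℝ E F)) p := by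
    intro p
    have h1 : HasFDerivAt (fun q : EProd E F => q.fst - x₀) (WithLp.fstL 2 ℝ E F) p :=
      (WithLp.fstL 2 ℝ E F).hasFDerivAt.sub_const x₀
    have h2 : HasFDerivAt (fun q : EProd E F => q.snd - w) (WithLp.sndL 2 ℝ E F) p :=
      (WithLp.sndL 2 ℝ E F).hasFDerivAt.sub_const w
    exact ((((innerSL ℝ ξ).hasFDerivAt.comp p h1).neg).add
      (((hasFDerivAt_smoothNorm hδ _).comp p h1).const_mul (2 * ε))).add
      (((hasFDerivAt_smoothNorm hδ _).comp p h2).const_mul b)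
  have hcont : Continuous φ := continuous_iff_continuousAt.2 fun p => (hder p).continuousAt
  have hp₀ : pair x₀ w ∈ gph Φ ∩ Metric.closedBall (pair x₀ w) r :=
    ⟨hx₀, Metric.mem_closedBall_self hr.le⟩
  obtain ⟨p, ⟨hpΦ, hpr⟩, hmin⟩ := ((isCompact_closedBall (pair x₀ w) r).inter_left
    hΦ).exists_isMinOn ⟨_, hp₀⟩ hcont.continuousOn
  have hval : φ p ≤ (2 * ε + b) * δ := by
    have := hmin hp₀
    simp only [mem_ofPred_eq, hφ, WithLp.toLp_fst, WithLp.toLp_snd, sub_self, inner_zero_right,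
      smoothNorm_zero hδ] at this
    simp only [hφ]
    linarith
  rw [mem_closedBall_iff_norm] at hpr
  have hfst : ‖p.fst - x₀‖ ≤ ‖p - pair x₀ w‖ := WithLp.norm_fst_le _ (p - pair x₀ w)
  have hsnd : ‖p.snd - w‖ ≤ ‖p - pair x₀ w‖ := WithLp.norm_snd_le _ (p - pair x₀ w)
  have hsum : ‖p - pair x₀ w‖ ≤ ‖p.fst - x₀‖ + ‖p.snd - w‖ := by
    have h : ‖p - pair x₀ w‖ ^ 2 = ‖p.fst - x₀‖ ^ 2 + ‖p.snd - w‖ ^ 2 :=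
      WithLp.prod_norm_sq_eq_of_L2 (p - pair x₀ w)
    refine abs_le_of_sq_le_sq' ?_ (by positivity) |>.2
    nlinarith [mul_nonneg (norm_nonneg (p.fst - x₀)) (norm_nonneg (p.snd - w))]
  have hlow : ε * ‖p - pair x₀ w‖ ≤ φ p := by
    have h1 := hpen p.fst p.snd hpΦ (hfst.trans hpr) (hsnd.trans hpr)
    have h2 := mul_le_mul_of_nonneg_left (norm_le_smoothNorm δ (p.fst - x₀))
      (by positivity : 0 ≤ 2 * ε)
    have h3 := mul_le_mul_of_nonneg_left (norm_le_smoothNorm δ (p.snd - w)) hbpos.le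
    have h4 := mul_le_mul_of_nonneg_left hsum hε.le
    simp only [hφ]
    rw [hb] at h3 ⊢
    linarith
  have hnear : ‖p - pair x₀ w‖ < min r ε :=
    lt_of_mul_lt_mul_left (hlow.trans_lt (hval.trans_lt hδr)) hε.le
  have hloc : IsLocalMinOn φ (gph Φ) p := by
    have hball : Metric.closedBall (pair x₀ w) r ∈ 𝓝 p :=
      mem_of_superset (Metric.isOpen_ball.mem_nhds
        (mem_ball_iff_norm.2 (hnear.trans_le (min_le_left _ _)))) Metric.ball_subset_closedBall
    filter_upwards [mem_nhdsWithin_of_mem_nhds hball, self_mem_nhdsWithin] with q hq hqΦ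
    exact hmin ⟨hqΦ, hq⟩
  -- The normal is minus the gradient of `φ` at the minimizer.
  refine ⟨p, hpΦ, (hnear.trans_le (min_le_right _ _)).le,
    ξ - (2 * ε) • (smoothNorm δ (p.fst - x₀))⁻¹ • (p.fst - x₀),
    -(b • (smoothNorm δ (p.snd - w))⁻¹ • (p.snd - w)), ?_, ?_,
    IsLocalMinOn.mem_regularNormalCone hloc (hder p) fun d => ?_⟩
  · rw [sub_sub_cancel_left, norm_neg, norm_smul, Real.norm_of_nonneg (by positivity)]
    exact mul_le_of_le_one_right (by positivity) (norm_inv_smoothNorm_smul_le hδ _)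
  · rw [norm_neg, norm_smul, Real.norm_of_nonneg hbpos.le]
    exact mul_le_of_le_one_right hbpos.le (norm_inv_smoothNorm_smul_le hδ _)
  · rw [WithLp.prod_inner_apply]
    simp [inner_sub_left, inner_smul_left]
    ring

/-- Limiting normals to a preimage under a metrically subregular mapping with closed graph are
contained in the range of its coderivative. -/
theorem MetricallySubregularAt.exists_mem_coderivative [InnerProductSpace ℝ F] [FiniteDimensional ℝ F]
    {Φ : E → Set F}
    (hΦ : IsClosed (gph Φ)) {x ξ : E} {w : F} (hsub : MetricallySubregularAt Φ x w)
    (hξ : ξ ∈ limitingNormalCone (inv Φ w) x) : ∃ η, ξ ∈ coderivative Φ x w η := by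
  obtain ⟨κ, -, U, hU, hsub⟩ := hsub
  obtain ⟨u, ζ, huC, hux, hζξ, hζ⟩ := hξ
  -- From `N` on, `U` is a neighbourhood of `u k`, so one `κ` serves every approximating point.
  obtain ⟨N, hN⟩ := eventually_atTop.1 (hux.eventually (eventually_mem_nhds_iff.2 hU))
  have hε : ∀ k : ℕ, (0 : ℝ) < 1 / ((k : ℝ) + 1) := fun k => by positivity
  have hε0 : Tendsto (fun k : ℕ => 1 / ((k : ℝ) + 1)) atTop (𝓝 0) :=
    tendsto_one_div_add_atTop_nhds_zero_nat
  choose p hpΦ hp ξ' η hξ' hη hn using fun k : ℕ =>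
    exists_regularNormalCone_gph_near hΦ (hN (k + N) (Nat.le_add_left _ _)) hsub (huC _) (hζ _)
      (hε k)
  have hux' := (tendsto_add_atTop_iff_nat N).2 hux
  have hζξ' := (tendsto_add_atTop_iff_nat N).2 hζξ
  obtain ⟨C, hC⟩ : ∃ C, ∀ k, ‖η k‖ ≤ C := by
    have hlim := ((hζξ'.norm.add hε0).mul_const (κ : ℝ)).add hε0
    obtain ⟨C, hC⟩ := hlim.bddAbove_range
    exact ⟨C, fun k => (hη k).trans (hC ⟨k, rfl⟩)⟩
  obtain ⟨η₀, -, θ, hθ, hη₀⟩ := (isCompact_closedBall (0 : F) C).tendsto_subseq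
    (x := η) (fun k => mem_closedBall_zero_iff.2 (hC k))
  have hpair : ∀ {a : ℕ → E} {b : ℕ → F} {a₀ : E} {b₀ : F}, Tendsto a atTop (𝓝 a₀) →
      Tendsto b atTop (𝓝 b₀) →
      Tendsto (fun k => pair (a k) (b k)) atTop (𝓝 (pair a₀ b₀)) := fun ha hb =>
    ((WithLp.prod_continuous_toLp 2 E F).tendsto _).comp (ha.prodMk_nhds hb)
  have hplim : Tendsto p atTop (𝓝 (pair x w)) := by
    have h1 : Tendsto (fun k => p k - pair (u (k + N)) w) atTop (𝓝 0) :=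
      squeeze_zero_norm hp hε0
    simpa using h1.add (hpair hux' (tendsto_const_nhds (x := w)))
  have hξlim : Tendsto ξ' atTop (𝓝 ξ) := by
    have h1 : Tendsto (fun k => ξ' k - ζ (k + N)) atTop (𝓝 0) :=
      squeeze_zero_norm hξ' (by simpa using hε0.const_mul 2)
    simpa using h1.add hζξ'
  refine ⟨-η₀, p ∘ θ, fun k => pair (ξ' (θ k)) (η (θ k)), fun k => hpΦ _,
    hplim.comp hθ.tendsto_atTop, ?_, fun k => hn _⟩
  rw [neg_neg]
  exact hpair (hξlim.comp hθ.tendsto_atTop) hη₀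

end Subregularity

/-! ### Lifting normals from `H` to `𝓗̂` and descending to `𝓗` -/

section Composition

variable {n m s : ℕ} {F : Rn n → Set (Rn m)} {G : EProd (Rn n) (Rn m) → Set (Rn s)}

theorem mem_gph_mapCalH {p : EProd (EProd (Rn n) (Rn m)) (EProd (Rn m) (Rn s))} :
    p ∈ gph (mapCalH F G) ↔ p.snd.fst + p.fst.snd ∈ F p.fst.fst ∧ p.snd.snd ∈ G p.fst := by
  simp [gph, mapCalH, prodSet, sub_singleton, sub_eq_iff_eq_add]

theorem mem_gph_mapCalHhat
    {p : EProd (EProd (Rn n) (EProd (Rn s) (Rn m))) (EProd (Rn m) (Rn s))} :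
    p ∈ gph (mapCalHhat F G) ↔ p.snd.fst + p.fst.snd.snd ∈ F p.fst.fst ∧
      p.snd.snd + p.fst.snd.fst ∈ G (pair p.fst.fst p.fst.snd.snd) := by
  simp [gph, mapCalHhat, prodSet, sub_singleton, sub_eq_iff_eq_add]

theorem mem_inv_mapCalHhat {p : EProd (Rn n) (EProd (Rn s) (Rn m))} :
    p ∈ inv (mapCalHhat F G) (pair 0 0) ↔
      p.snd.snd ∈ F p.fst ∧ p.snd.fst ∈ G (pair p.fst p.snd.snd) := by
  simp [inv, mapCalHhat, prodSet, sub_singleton, sub_eq_zero]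

theorem isClosed_gph_mapCalHhat (hF : IsClosed (gph F)) (hG : IsClosed (gph G)) :
    IsClosed (gph (mapCalHhat F G)) := by
  have h1 : Continuous fun p : EProd (EProd (Rn n) (EProd (Rn s) (Rn m))) (EProd (Rn m) (Rn s)) =>
    pair p.fst.fst (p.snd.fst + p.fst.snd.snd) := by fun_prop
  have h2 : Continuous fun p : EProd (EProd (Rn n) (EProd (Rn s) (Rn m))) (EProd (Rn m) (Rn s)) =>
    pair (pair p.fst.fst p.fst.snd.snd) (p.snd.snd + p.fst.snd.fst) := by fun_prop
  convert! (hF.preimage h1).inter (hG.preimage h2) using 1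
  ext p
  exact mem_gph_mapCalHhat

/-- Makes sequences in `gph H` admissible for inner semicompactness of `K̂` relative to its domain.
-/
theorem mem_gph_mapH {q : EProd (Rn n) (Rn s)} :
    q ∈ gph (mapH F G) ↔ (mapKhat F G q).Nonempty := by
  simp [gph, mapH, mapKhat, Set.Nonempty]

/-- Regular normals to `gph H` lift to the zero set of `𝓗̂`. -/
theorem regularNormalCone_inv_mapCalHhat {z : Rn n} {w : Rn s} {l : Rn m} {ξ : Rn n} {ν : Rn s}
    (h : pair ξ ν ∈ regularNormalCone (gph (mapH F G)) (pair z w)) :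
    pair ξ (pair ν 0) ∈
      regularNormalCone (inv (mapCalHhat F G) (pair 0 0)) (pair z (pair w l)) := by
  let L : EProd (Rn n) (EProd (Rn s) (Rn m)) →ₗ[ℝ] EProd (Rn n) (Rn s) :=
    { toFun := fun p => pair p.fst p.snd.fst
      map_add' := fun _ _ => rfl
      map_smul' := fun _ _ => rfl }
  have hL : ∀ p, L p = pair p.fst p.snd.fst := fun _ => rfl
  have hLc : Continuous L := by
    change Continuous fun p : EProd (Rn n) (EProd (Rn s) (Rn m)) => pair p.fst p.snd.fst
    fun_prop
  refine regularNormalCone_of_map L hLc 0 (fun p hp => ?_) ?_ h fun d => ?_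
  · rw [add_zero, mem_gph_mapH]
    exact ⟨p.snd.snd, mem_inv_mapCalHhat.1 hp⟩
  · rw [add_zero, hL]
    rfl
  · simp only [hL, WithLp.prod_inner_apply, WithLp.ofLp_fst, WithLp.ofLp_snd,
      inner_zero_left, add_zero]

/-- The structure of regular normals to `gph 𝓗̂`, a linear preimage of `gph 𝓗`. -/
theorem regularNormalCone_gph_mapCalHhat
    {p ζ : EProd (EProd (Rn n) (EProd (Rn s) (Rn m))) (EProd (Rn m) (Rn s))}
    (hp : p ∈ gph (mapCalHhat F G)) (h : ζ ∈ regularNormalCone (gph (mapCalHhat F G)) p) :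
    ζ.fst.snd.fst = ζ.snd.snd ∧
      pair (pair ζ.fst.fst ζ.fst.snd.snd) ζ.snd ∈ regularNormalCone (gph (mapCalH F G))
        (pair (pair p.fst.fst p.fst.snd.snd) (pair p.snd.fst (p.snd.snd + p.fst.snd.fst))) := by
  constructor
  -- Moving `w` and the second value oppositely preserves their sum, hence the graph. Testing with
  -- the difference of the two normal components shows that its squared norm is nonpositive.
  · have hT : pair (pair 0 (pair (ζ.fst.snd.fst - ζ.snd.snd) 0))
        (pair 0 (-(ζ.fst.snd.fst - ζ.snd.snd))) ∈ tangentCone (gph (mapCalHhat F G)) p := by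
      refine mem_tangentCone_of_line fun t => ?_
      rw [mem_gph_mapCalHhat] at hp ⊢
      have e1 : p.snd.fst + t • (0 : Rn m) + (p.fst.snd.snd + t • (0 : Rn m)) =
          p.snd.fst + p.fst.snd.snd := by simp
      have e2 : p.snd.snd + t • -(ζ.fst.snd.fst - ζ.snd.snd) +
          (p.fst.snd.fst + t • (ζ.fst.snd.fst - ζ.snd.snd)) = p.snd.snd + p.fst.snd.fst := by
        rw [smul_neg]; abel
      have e3 : p.fst.fst + t • (0 : Rn n) = p.fst.fst := by simp
      have e4 : p.fst.snd.snd + t • (0 : Rn m) = p.fst.snd.snd := by simp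
      simp only [WithLp.add_fst, WithLp.add_snd, WithLp.smul_fst, WithLp.smul_snd,
        WithLp.toLp_fst, WithLp.toLp_snd]
      rw [e1, e2, e3, e4]
      exact hp
    have := h _ hT
    simp only [WithLp.prod_inner_apply, WithLp.ofLp_fst, WithLp.ofLp_snd, inner_zero_right,
      inner_neg_right, zero_add, add_zero] at this
    rw [← sub_eq_add_neg, ← inner_sub_left] at this
    exact sub_eq_zero.1 (inner_self_eq_zero.1 (le_antisymm this real_inner_self_nonneg))
  -- Freezing `w` at its value in `p` embeds `gph 𝓗` affinely into `gph 𝓗̂`; regular normals pull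
  -- back along this embedding.
  · let L : EProd (EProd (Rn n) (Rn m)) (EProd (Rn m) (Rn s)) →ₗ[ℝ]
        EProd (EProd (Rn n) (EProd (Rn s) (Rn m))) (EProd (Rn m) (Rn s)) :=
      { toFun := fun q => pair (pair q.fst.fst (pair 0 q.fst.snd)) q.snd
        map_add' := fun x y => by
          simp only [WithLp.add_fst, WithLp.add_snd, ← WithLp.toLp_add, Prod.mk_add_mk, add_zero]
        map_smul' := fun c x => by
          simp only [WithLp.smul_fst, WithLp.smul_snd, ← WithLp.toLp_smul, Prod.smul_mk,
            smul_zero, RingHom.id_apply] }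
    have hL : ∀ q, L q = pair (pair q.fst.fst (pair 0 q.fst.snd)) q.snd := fun _ => rfl
    have hLc : Continuous L := by
      change Continuous fun q : EProd (EProd (Rn n) (Rn m)) (EProd (Rn m) (Rn s)) =>
        pair (pair q.fst.fst (pair (0 : Rn s) q.fst.snd)) q.snd
      fun_prop
    refine regularNormalCone_of_map L hLc
      (pair (pair 0 (pair p.fst.snd.fst 0)) (pair 0 (-p.fst.snd.fst))) (fun q hq => ?_)
      ?_ h fun d => ?_
    · rw [mem_gph_mapCalH] at hq
      rw [mem_gph_mapCalHhat]
      simp only [hL, WithLp.add_fst, WithLp.add_snd, WithLp.toLp_fst, WithLp.toLp_snd, add_zero,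
        zero_add, neg_add_cancel_right]
      exact hq
    · have e : p.snd.snd + p.fst.snd.fst + -p.fst.snd.fst = p.snd.snd := by abel
      simp only [hL, WithLp.toLp_fst, WithLp.toLp_snd, ← WithLp.toLp_add, Prod.mk_add_mk, add_zero,
        zero_add]
      rw [e]
      rfl
    · simp only [hL, WithLp.prod_inner_apply, WithLp.ofLp_fst, WithLp.ofLp_snd,
        inner_zero_right, zero_add]

/-- The coderivatives of `𝓗̂` in terms of those of `𝓗`. -/
theorem coderivative_mapCalHhat {z ξ : Rn n} {l : Rn m} {ν : Rn s} {η : EProd (Rn m) (Rn s)}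
    (h : pair ξ (pair (-ν) 0) ∈
      coderivative (mapCalHhat F G) (pair z (pair 0 l)) (pair 0 0) η) :
    pair ξ 0 ∈ coderivative (mapCalH F G) (pair z l) (pair 0 0) (pair η.fst ν) := by
  obtain ⟨u, ζ, hu, hulim, hζlim, hζ⟩ := h
  have hst := fun k => regularNormalCone_gph_mapCalHhat (hu k) (hζ k)
  have hc1 : Continuous fun p : EProd (EProd (Rn n) (EProd (Rn s) (Rn m))) (EProd (Rn m) (Rn s)) =>
    pair (pair p.fst.fst p.fst.snd.snd) (pair p.snd.fst (p.snd.snd + p.fst.snd.fst)) := by fun_prop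
  have hc2 : Continuous fun p : EProd (EProd (Rn n) (EProd (Rn s) (Rn m))) (EProd (Rn m) (Rn s)) =>
    pair (pair p.fst.fst p.fst.snd.snd) p.snd := by fun_prop
  have hc3 : Continuous fun p : EProd (EProd (Rn n) (EProd (Rn s) (Rn m))) (EProd (Rn m) (Rn s)) =>
    p.fst.snd.fst - p.snd.snd := by fun_prop
  -- The equality of components of the approximating regular normals survives in the limit.
  have hη : ν = η.snd := by
    have h3 := (hc3.tendsto _).comp hζlim
    have h0 : Tendsto (fun _ : ℕ => (0 : Rn s)) atTop (𝓝 0) := tendsto_const_nhds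
    have := tendsto_nhds_unique (h0.congr fun k => (sub_eq_zero.2 (hst k).1).symm) h3
    simp only [WithLp.toLp_fst, WithLp.toLp_snd, WithLp.neg_snd, sub_neg_eq_add] at this
    exact (neg_add_eq_zero.1 this.symm)
  subst hη
  refine ⟨_, _, fun k => ?_, ?_, (hc2.tendsto _).comp hζlim, fun k => (hst k).2⟩
  · have := mem_gph_mapCalHhat.1 (hu k)
    rw [mem_gph_mapCalH]
    simpa using this
  · have h1 := (hc1.tendsto _).comp hulim
    simp only [WithLp.toLp_fst, WithLp.toLp_snd, add_zero] at h1
    exact h1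

/-- Coderivatives of `H` are coderivatives of `𝓗` at an accumulation point of intermediate
variables. -/
theorem exists_mem_coderivative_mapCalH (hF : IsClosed (gph F)) (hG : IsClosed (gph G)) {z : Rn n}
    (hK : InnerSemicompactAt (mapKhat F G) (pair z 0) (dom (mapKhat F G)))
    (hH : ∀ l ∈ mapK F G z,
      MetricallySubregularAt (mapCalHhat F G) (pair z (pair 0 l)) (pair 0 0))
    {ξ : Rn n} {ν : Rn s} (hξ : ξ ∈ coderivative (mapH F G) z 0 ν) :
    ∃ l ∈ mapK F G z, ∃ μ : Rn m,
      pair ξ 0 ∈ coderivative (mapCalH F G) (pair z l) (pair 0 0) (pair μ ν) := by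
  obtain ⟨u, ζ, hu, hulim, hζlim, hζ⟩ := hξ
  obtain ⟨θ, v, l, hθ, hv, hvK⟩ := hK u (fun k => mem_gph_mapH.1 (hu k)) hulim
  have hulim' := hulim.comp hθ.tendsto_atTop
  have hζlim' := hζlim.comp hθ.tendsto_atTop
  have hpt : Tendsto (fun k => pair (u (θ k)).fst (pair (u (θ k)).snd (v k))) atTop
      (𝓝 (pair z (pair 0 l))) := by
    have hc : Continuous fun q : EProd (Rn n) (Rn s) × Rn m =>
      pair q.1.fst (pair q.1.snd q.2) := by fun_prop
    exact (hc.tendsto (pair z 0, l)).comp (hulim'.prodMk_nhds hv)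
  have hmem : ∀ k, pair (u (θ k)).fst (pair (u (θ k)).snd (v k)) ∈
      inv (mapCalHhat F G) (pair 0 0) := fun k => mem_inv_mapCalHhat.2 (hvK k)
  have hl : l ∈ mapK F G z := by
    have hcl : IsClosed (inv (mapCalHhat F G) (pair 0 0)) := by
      have hc : Continuous fun p : EProd (Rn n) (EProd (Rn s) (Rn m)) =>
        pair p (pair (0 : Rn m) (0 : Rn s)) := by fun_prop
      exact (isClosed_gph_mapCalHhat hF hG).preimage hc
    exact mem_inv_mapCalHhat.1 (hcl.mem_of_tendsto hpt (Eventually.of_forall hmem))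
  have hn : pair ξ (pair (-ν) 0) ∈
      limitingNormalCone (inv (mapCalHhat F G) (pair 0 0)) (pair z (pair 0 l)) := by
    refine ⟨_, fun k => pair (ζ (θ k)).fst (pair (ζ (θ k)).snd 0), hmem, hpt, ?_,
      fun k => regularNormalCone_inv_mapCalHhat (hζ (θ k))⟩
    have hc : Continuous fun q : EProd (Rn n) (Rn s) =>
      pair q.fst (pair q.snd (0 : Rn m)) := by fun_prop
    exact (hc.tendsto (pair ξ (-ν))).comp hζlim'
  obtain ⟨η, hη⟩ := (hH l hl).exists_mem_coderivative (isClosed_gph_mapCalHhat hF hG) hn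
  exact ⟨l, hl, η.fst, coderivative_mapCalHhat hη⟩

end Composition

end ImplicitVar

/-! ### Assembling the stationarity conditions -/

theorem proposition4p14 {n m s : ℕ}
    (f : Rn n → ℝ) (hf : LocallyLipschitz f)
    (F : Rn n → Set (Rn m)) (hF : IsClosed (gph F))
    (G : EProd (Rn n) (Rn m) → Set (Rn s)) (hG : IsClosed (gph G))
    (M : Set (Rn n)) (hM : IsClosed M)
    (z : Rn n) (hz : ImplicitlyMStationary f F G M z)
    (hK : InnerSemicompactAt (mapKhat F G) (pair z 0) (dom (mapKhat F G)))
    (hH : ∀ l ∈ mapK F G z,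
      MetricallySubregularAt (mapCalHhat F G) (pair z (pair 0 l)) (pair 0 0)) :
    FuzzilyMStationary f F G M z ∧
      ((∀ l ∈ mapK F G z, Inc F G z l) → ExplicitlyMStationary f F G M z) := by
  obtain ⟨hfeas, ν, hν⟩ := hz
  obtain ⟨_, ⟨ξf, hξf, ξ, hξ, rfl⟩, ξM, hξM, hsum⟩ := hν
  obtain ⟨l, hl, μ, hc⟩ := exists_mem_coderivative_mapCalH hF hG hK hH hξ
  simp only at hsum
  refine ⟨⟨hfeas, l, hl, μ, ν, ?_⟩, fun hInc => ⟨hfeas, l, hl, μ, ν, ?_⟩⟩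
  · refine ⟨_, ⟨pair ξf 0, ⟨hξf, rfl⟩, _, hc, rfl⟩, pair ξM 0, ⟨hξM, rfl⟩, ?_⟩
    simp only [← hsum, ← WithLp.toLp_add, Prod.mk_add_mk, add_zero]
  · obtain ⟨a, ⟨ha, ha'⟩, b, hb, hab⟩ := hInc l hl μ ν hc
    have h1 : a.fst + b.fst = ξ := congrArg WithLp.fst hab
    have h2 : a.snd + b.snd = 0 := congrArg WithLp.snd hab
    -- The zero second component forces `b.snd = μ`, the coupling demanded by explicit stationarity.
    rw [mem_singleton_iff.1 ha', neg_add_eq_zero] at h2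
    refine ⟨_, ⟨_, ⟨ξf, hξf, _, ha, rfl⟩, b.fst, ?_, rfl⟩, ξM, hξM, ?_⟩
    · rw [mem_ofPred_eq, h2]
      exact hb
    · simp only [add_assoc, ← h1] at hsum ⊢
      exact hsum
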